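/- The power graph of a finite group $G$ is the graph with vertex set $G$ in which two distinct elements are adjacent if and only if one of them is a power of the other. A cograph is a graph that has no induced subgraph isomorphic to the path $P_4$ on four vertices. Let $q$ be a prime power with $q\neq 2$ (that is, either $q$ is odd, or $q\geq 4$ is a power of $2$). Let $\mathrm{SU}(3,q)$ be the group of all $3\times 3$ matrices $A$ of determinant $1$ over the field with $q^2$ elements such that $A\,\overline{A}^{\,T}=I$, where $\overline{A}$ is obtained from $A$ by raising every entry to the power $q$, and let $\mathrm{PSU}(3,q)$ be its quotient by its centre. Then the power graph of $\mathrm{PSU}(3,q)$ is not a cograph. -/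

import Mathlib

/-- The (undirected) power graph of `G`: two distinct elements are adjacent when one of them is
a power of the other. -/
def powerGraph (G : Type*) [Group G] : SimpleGraph G where
  Adj u v := u ≠ v ∧ ((∃ k : ℕ, 0 < k ∧ u ^ k = v) ∨ (∃ k : ℕ, 0 < k ∧ v ^ k = u))
  symm := ⟨fun _ _ h => ⟨h.1.symm, h.2.symm⟩⟩
  loopless := ⟨fun _ h => h.1 rfl⟩

/-- A cograph is a graph without an induced path on four vertices. -/
def IsCograph {V : Type*} (Γ : SimpleGraph V) : Prop :=
  ¬ (SimpleGraph.pathGraph 4).IsIndContained Γ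

/-- The finite field with `q ^ 2` elements, where `q = p ^ n`, equipped below with its
involution `x ↦ x ^ q`. -/
def GFSq (p n : ℕ) [Fact p.Prime] : Type := GaloisField p (2 * n)

namespace GFSq

variable (p n : ℕ) [Fact p.Prime]

noncomputable instance : Field (GFSq p n) := inferInstanceAs (Field (GaloisField p (2 * n)))

instance : Finite (GFSq p n) := inferInstanceAs (Finite (GaloisField p (2 * n)))

instance : CharP (GFSq p n) p := inferInstanceAs (CharP (GaloisField p (2 * n)) p)

theorem natCard (hn : n ≠ 0) : Nat.card (GFSq p n) = (p ^ n) ^ 2 := by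
  have h := GaloisField.card p (2 * n) (by omega)
  rw [mul_comm, pow_mul] at h
  simpa [GFSq, mul_comm] using h

theorem pow_pow_eq_self (x : GFSq p n) : (x ^ p ^ n) ^ p ^ n = x := by
  rcases eq_or_ne n 0 with rfl | hn
  · simp
  · have : Fintype (GFSq p n) := Fintype.ofFinite _
    have h := FiniteField.pow_card x
    rw [← Nat.card_eq_fintype_card, natCard p n hn] at h
    rw [← pow_mul, ← sq, h]

/-- The conjugation `x ↦ x ^ q`, `q = p ^ n`, on the field with `q ^ 2` elements. -/
noncomputable instance : StarRing (GFSq p n) where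
  star x := x ^ p ^ n
  star_involutive := pow_pow_eq_self p n
  star_mul x y := by
    change (x * y) ^ p ^ n = y ^ p ^ n * x ^ p ^ n
    rw [mul_pow, mul_comm]
  star_add x y := add_pow_char_pow x y p n

theorem star_eq (x : GFSq p n) : star x = x ^ p ^ n := rfl

end GFSq

/-- The special unitary group `SU(d, q)`, `q = p ^ n`: the `d × d` matrices `A` of determinant `1`
over the field with `q ^ 2` elements such that `A * A̅ᵀ = 1`, where the bar is the entrywise
conjugation `x ↦ x ^ q`. -/
abbrev SU (d p n : ℕ) [Fact p.Prime] : Type :=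
  Matrix.specialUnitaryGroup (Fin d) (GFSq p n)

/-- The projective special unitary group `PSU(d, q)`, `q = p ^ n`: the quotient of `SU(d, q)` by
its centre. -/
abbrev PSU (d p n : ℕ) [Fact p.Prime] : Type :=
  SU d p n ⧸ Subgroup.center (SU d p n)

/-!
The power graph of a group contains an induced path `a - b - c - d` as soon as `a` and `c` are
nontrivial powers of `b` with coprime orders, and `c` is a power of an element `d` which does not
commute with `a` (`not_isCograph_powerGraph`).

In `PSU(3, q)` with `q = p ^ n ≠ 2`, such elements are found in the centralizer `GU(2, q)` of
`c = diag(l, l, l⁻²)`, where `l` has order `q + 1`. Since `q + 1 > 3`, the element `c` is nontrivial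
modulo the centre; its order divides `q + 1`, hence is prime to `p`. The group `SU(2, q)` contains
noncommuting transvections `a` and `a'`, of order `p`, attached to two isotropic vectors. Put
`b = a * c` and `d = a' * c`. As `q ^ 2` is `0` modulo `p` and `1` modulo `q + 1`, while `q + 1` is
`1` modulo `p` and `0` modulo `q + 1`, we get `b ^ (q ^ 2) = c = d ^ (q ^ 2)` and `b ^ (q + 1) = a`.
The commutator of `a` and `a'` fixes the third basis vector, so if it were central it would commute
with the cyclic permutation of the basis and be trivial; hence `a` and `d` do not
commute modulo the centre either.
-/

/-! ### Induced paths in power graphs -/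

theorem eq_one_of_pow_eq_of_coprime {G : Type*} [Group G] {x y : G}
    (h : (orderOf x).Coprime (orderOf y)) {k : ℕ} (hk : x ^ k = y) : y = 1 := by
  have h1 : orderOf y ∣ orderOf x := by
    rw [← hk]; exact orderOf_pow_dvd k
  exact orderOf_eq_one_iff.mp (Nat.eq_one_of_dvd_coprimes h h1 dvd_rfl)

/-- The elements `a`, `b`, `c`, `d`, in this order, form an induced path of the power graph. -/
theorem not_isCograph_powerGraph {G : Type*} [Group G] {a b c d : G} {k l m : ℕ}
    (hk : 0 < k) (hl : 0 < l) (hm : 0 < m) (hba : b ^ k = a) (hbc : b ^ l = c) (hdc : d ^ m = c)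
    (ha : a ≠ 1) (hc : c ≠ 1) (hco : (orderOf a).Coprime (orderOf c)) (had : ¬ Commute a d) :
    ¬ IsCograph (powerGraph G) := by
  have hac : Commute a c := by
    rw [← hba, ← hbc]; exact (Commute.refl b).pow_pow k l
  have nac : ∀ j : ℕ, a ^ j ≠ c := fun j h => hc (eq_one_of_pow_eq_of_coprime hco h)
  have nca : ∀ j : ℕ, c ^ j ≠ a := fun j h => ha (eq_one_of_pow_eq_of_coprime hco.symm h)
  have nad : ∀ j : ℕ, a ^ j ≠ d := fun j h => had (h ▸ (Commute.refl a).pow_right j)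
  have nda : ∀ j : ℕ, d ^ j ≠ a := fun j h => had (h ▸ (Commute.refl d).pow_left j)
  have nbd : ∀ j : ℕ, b ^ j ≠ d := fun j h => had (by
    rw [← h, ← hba]; exact (Commute.refl b).pow_pow k j)
  have ndb : ∀ j : ℕ, d ^ j ≠ b := fun j h => nda (j * k) (by rw [pow_mul, h, hba])
  have ab : a ≠ b := fun h => nac l (h ▸ hbc)
  have bc : b ≠ c := fun h => nca k (h ▸ hba)
  have cd : c ≠ d := fun h => had (h ▸ hac)
  have ac : a ≠ c := fun h => nac 1 (by rw [pow_one, h])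
  have ad : a ≠ d := fun h => nad 1 (by rw [pow_one, h])
  have bd : b ≠ d := fun h => nbd 1 (by rw [pow_one, h])
  have eab : (powerGraph G).Adj a b := ⟨ab, Or.inr ⟨k, hk, hba⟩⟩
  have ebc : (powerGraph G).Adj b c := ⟨bc, Or.inl ⟨l, hl, hbc⟩⟩
  have ecd : (powerGraph G).Adj c d := ⟨cd, Or.inr ⟨m, hm, hdc⟩⟩
  have eac : ¬ (powerGraph G).Adj a c := by
    rintro ⟨-, ⟨j, -, h⟩ | ⟨j, -, h⟩⟩
    exacts [nac j h, nca j h]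
  have ead : ¬ (powerGraph G).Adj a d := by
    rintro ⟨-, ⟨j, -, h⟩ | ⟨j, -, h⟩⟩
    exacts [nad j h, nda j h]
  have ebd : ¬ (powerGraph G).Adj b d := by
    rintro ⟨-, ⟨j, -, h⟩ | ⟨j, -, h⟩⟩
    exacts [nbd j h, ndb j h]
  refine not_not_intro ⟨⟨⟨![a, b, c, d], ?_⟩, ?_⟩⟩
  · intro i j
    fin_cases i <;> fin_cases j <;>
      simp [ab, bc, cd, ac, ad, bd, ab.symm, bc.symm, cd.symm, ac.symm, ad.symm, bd.symm]
  · intro i j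
    change (powerGraph G).Adj (![a, b, c, d] i) (![a, b, c, d] j) ↔ _
    fin_cases i <;> fin_cases j <;>
      simp [SimpleGraph.pathGraph_adj, eab, ebc, ecd, eac, ead, ebd, eab.symm, ebc.symm, ecd.symm,
        mt SimpleGraph.Adj.symm eac, mt SimpleGraph.Adj.symm ead, mt SimpleGraph.Adj.symm ebd]

/-! ### Three-dimensional unitary matrices over a field with involution -/

section Matrices

variable {F : Type*} [Field F] [StarRing F]

/-- The map `x ↦ x + t ⟨x, v⟩ v` of `F³`, where `v = (1, i * k, 0)`. It is a unitary transvection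
when `i * star i = -1`, `k * star k = 1` and `star t = -t`. -/
def transvectionMatrix (t i k : F) : Matrix (Fin 3) (Fin 3) F :=
  !![1 + t, t * star i * star k, 0; t * i * k, 1 - t, 0; 0, 0, 1]

/-- The diagonal matrix `diag(l, l, l⁻²)`, for `l` of norm `1`, so that `l⁻¹ = star l`. -/
def planeScalarMatrix (l : F) : Matrix (Fin 3) (Fin 3) F :=
  !![l, 0, 0; 0, l, 0; 0, 0, star l ^ 2]

/-- The cyclic permutation matrix of size three. -/
def cyclicMatrix (F : Type*) [Field F] : Matrix (Fin 3) (Fin 3) F :=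
  !![0, 1, 0; 0, 0, 1; 1, 0, 0]

theorem transvectionMatrix_mem {t i k : F} (ht : star t = -t) (hi : i * star i = -1)
    (hk : k * star k = 1) :
    transvectionMatrix t i k ∈ Matrix.specialUnitaryGroup (Fin 3) F := by
  rw [Matrix.mem_specialUnitaryGroup_iff, Matrix.mem_unitaryGroup_iff]
  constructor
  · ext r s
    fin_cases r <;> fin_cases s <;>
      simp [transvectionMatrix, Matrix.mul_apply, Fin.sum_univ_three, Matrix.star_apply, ht]
    · linear_combination (-t ^ 2 * k * star k) * hi + t ^ 2 * hk
    · ring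
    · ring
    · linear_combination (-t ^ 2 * k * star k) * hi + t ^ 2 * hk
  · simp [transvectionMatrix, Matrix.det_fin_three]
    linear_combination (-t ^ 2 * k * star k) * hi + t ^ 2 * hk

theorem planeScalarMatrix_mem {l : F} (hl : l * star l = 1) :
    planeScalarMatrix l ∈ Matrix.specialUnitaryGroup (Fin 3) F := by
  rw [Matrix.mem_specialUnitaryGroup_iff, Matrix.mem_unitaryGroup_iff]
  constructor
  · ext r s
    fin_cases r <;> fin_cases s <;>
      simp [planeScalarMatrix, Matrix.mul_apply, Fin.sum_univ_three, Matrix.star_apply, hl]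
    linear_combination (l * star l + 1) * hl
  · simp [planeScalarMatrix, Matrix.det_fin_three]
    linear_combination (l * star l + 1) * hl

theorem cyclicMatrix_mem : cyclicMatrix F ∈ Matrix.specialUnitaryGroup (Fin 3) F := by
  rw [Matrix.mem_specialUnitaryGroup_iff, Matrix.mem_unitaryGroup_iff]
  constructor
  · ext r s
    fin_cases r <;> fin_cases s <;>
      simp [cyclicMatrix, Matrix.mul_apply, Fin.sum_univ_three, Matrix.star_apply]
  · simp [cyclicMatrix, Matrix.det_fin_three]

theorem commute_transvectionMatrix_planeScalarMatrix (t i k l : F) :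
    Commute (transvectionMatrix t i k) (planeScalarMatrix l) := by
  ext r s
  fin_cases r <;> fin_cases s <;>
    simp [transvectionMatrix, planeScalarMatrix, Matrix.mul_apply, Fin.sum_univ_three, mul_comm]

theorem transvectionMatrix_pow_char (p : ℕ) [Fact p.Prime] [CharP F p] {t i k : F}
    (hi : i * star i = -1) (hk : k * star k = 1) : transvectionMatrix t i k ^ p = 1 := by
  set N := transvectionMatrix t i k - 1 with hN
  have hN2 : N ^ 2 = 0 := by
    rw [hN, sq]
    ext r s
    fin_cases r <;> fin_cases s <;>
      simp [transvectionMatrix, Matrix.mul_apply, Fin.sum_univ_three]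
    · linear_combination (t ^ 2 * k * star k) * hi - t ^ 2 * hk
    · ring
    · ring
    · linear_combination (t ^ 2 * k * star k) * hi - t ^ 2 * hk
  have h : transvectionMatrix t i k = 1 + N := by rw [hN]; abel
  rw [h, add_pow_char_of_commute p (Commute.one_left N), one_pow,
    pow_eq_zero_of_le (Fact.out : p.Prime).two_le hN2, add_zero]

theorem planeScalarMatrix_pow_eq_one {l : F} {m : ℕ} (hl : l ^ m = 1) :
    planeScalarMatrix l ^ m = 1 := by
  have h : planeScalarMatrix l = Matrix.diagonal ![l, l, star l ^ 2] := by
    ext r s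
    fin_cases r <;> fin_cases s <;> simp [planeScalarMatrix]
  have h' : (star l) ^ m = 1 := by rw [← star_pow, hl, star_one]
  rw [h, Matrix.diagonal_pow, ← Matrix.diagonal_one]
  congr 1
  ext r
  fin_cases r <;> simp [hl, ← pow_mul, mul_comm 2 m]
  rw [pow_mul, h', one_pow]

theorem not_commute_planeScalarMatrix_cyclicMatrix {l : F} (h : l * star l = 1) (hl : l ^ 3 ≠ 1) :
    ¬ Commute (planeScalarMatrix l) (cyclicMatrix F) := by
  intro hcom
  have h1 := congrFun₂ hcom.eq 1 2
  simp [planeScalarMatrix, cyclicMatrix, Matrix.mul_apply, Fin.sum_univ_three] at h1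
  apply hl
  linear_combination l ^ 2 * h1 + (l * star l + 1) * h

theorem not_commute_transvectionMatrix {t i l : F} (ht : t ≠ 0) (hi : i * star i = -1)
    (h : l * star l = 1) (hl : l ^ 2 ≠ 1) :
    ¬ Commute (transvectionMatrix t i 1) (transvectionMatrix t i l) := by
  intro hcom
  have h1 := congrFun₂ hcom.eq 0 0
  simp [transvectionMatrix, Matrix.mul_apply, Fin.sum_univ_three] at h1
  have h2 : t ^ 2 * (l - star l) = 0 := by
    linear_combination (t ^ 2 * (l - star l)) * hi - h1
  rcases mul_eq_zero.mp h2 with h3 | h3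
  · exact ht (pow_eq_zero_iff two_ne_zero |>.mp h3)
  · apply hl
    linear_combination l * h3 + h

/-- If two transvections commute up to a factor commuting with the cyclic matrix, they commute:
the factor fixes the third basis vector. -/
theorem commute_transvectionMatrix_of_eq_mul {t i k k' : F} {z : Matrix (Fin 3) (Fin 3) F}
    (hz : Commute z (cyclicMatrix F))
    (h : transvectionMatrix t i k' * transvectionMatrix t i k =
      transvectionMatrix t i k * transvectionMatrix t i k' * z) :
    Commute (transvectionMatrix t i k) (transvectionMatrix t i k') := by
  have hrow (j : Fin 3) := congrFun₂ h 2 j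
  have e (r s : Fin 3) := congrFun₂ hz.eq r s
  have z20 := hrow 0
  have z21 := hrow 1
  have z22 := hrow 2
  have e00 := e 0 0
  have e01 := e 0 1
  have e02 := e 0 2
  have e10 := e 1 0
  have e11 := e 1 1
  have e12 := e 1 2
  simp [transvectionMatrix, Matrix.mul_apply, Fin.sum_univ_three] at z20 z21 z22
  simp [cyclicMatrix, Matrix.mul_apply, Fin.sum_univ_three] at e00 e01 e02 e10 e11 e12
  have hz1 : z = 1 := by
    ext r s
    fin_cases r <;> fin_cases s <;> simp <;> simp_all
  rw [hz1, mul_one] at h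
  exact h.symm

end Matrices

/-! ### Scalars in the field with `q ^ 2` elements -/

/-- There are an element `l` of norm `1` whose order exceeds three and an element `i` of norm
`-1`. Both are powers of a generator of the multiplicative group. -/
theorem GFSq.exists_norm_one_and_norm_neg_one (p n : ℕ) [Fact p.Prime] (hn : 1 ≤ n)
    (hq : p ^ n ≠ 2) :
    ∃ l i : GFSq p n, l * star l = 1 ∧ l ^ 2 ≠ 1 ∧ l ^ 3 ≠ 1 ∧ i * star i = -1 := by
  obtain ⟨g, hg⟩ := IsCyclic.exists_generator (α := (GFSq p n)ˣ)
  have hord : orderOf g = (p ^ n) ^ 2 - 1 := by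
    rw [orderOf_eq_card_of_forall_mem_zpowers hg, Nat.card_units, GFSq.natCard p n (by omega)]
  have hq2 : 2 ≤ p ^ n :=
    (Fact.out : p.Prime).two_le.trans (Nat.le_self_pow (by omega) p)
  simp only [GFSq.star_eq, ← pow_succ']
  have hneg : ((-1 : (GFSq p n)ˣ)) ^ (p ^ n - 1) = 1 := by
    have h : (-1 : GFSq p n) ^ p ^ n = -1 := by
      rw [← GFSq.star_eq, star_neg, star_one]
    have h' : (-1 : (GFSq p n)ˣ) ^ (p ^ n - 1) * (-1) = -1 := by
      rw [← pow_succ, Nat.sub_add_cancel (by omega)]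
      ext; simpa using h
    exact mul_eq_right.mp h'
  obtain ⟨k, hk⟩ := (mem_powers_iff_mem_zpowers).mpr (hg (-1))
  generalize p ^ n = q at *
  obtain ⟨r, rfl⟩ : ∃ r, q = r + 2 := ⟨q - 2, by omega⟩
  have hfac : (r + 2) ^ 2 - 1 = (r + 3) * (r + 1) := by
    rw [Nat.sub_eq_iff_eq_add (by nlinarith)]; ring
  rw [hfac] at hord
  have hr : 0 < r := by omega
  have hne (j : ℕ) (hj : 0 < j) (hj' : j ≤ 3) : ((g ^ (r + 1) : (GFSq p n)ˣ) : GFSq p n) ^ j ≠ 1 := by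
    intro h
    have h1 : g ^ ((r + 1) * j) = 1 := by
      ext; simpa [pow_mul] using h
    have h2 := Nat.le_of_dvd (by positivity) (orderOf_dvd_of_pow_eq_one h1)
    rw [hord] at h2
    nlinarith
  -- `-1 = g ^ k` has `(q - 1)`-th power `1`, so `q + 1` divides `k`.
  have hdvd : r + 3 ∣ k := by
    have h1 : g ^ (k * (r + 1)) = 1 := by
      rw [pow_mul]; dsimp at hk; rw [hk]; exact hneg
    have h2 := orderOf_dvd_of_pow_eq_one h1
    rw [hord] at h2
    exact Nat.dvd_of_mul_dvd_mul_right (by omega) h2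
  obtain ⟨s, rfl⟩ := hdvd
  refine ⟨(g ^ (r + 1) : (GFSq p n)ˣ), (g ^ s : (GFSq p n)ˣ), ?_, hne 2 (by omega) (by omega),
    hne 3 (by omega) le_rfl, ?_⟩
  · rw [← Units.val_pow_eq_pow_val, ← pow_mul,
      show (r + 1) * (r + 2 + 1) = orderOf g by rw [hord]; ring, pow_orderOf_eq_one, Units.val_one]
  · dsimp at hk
    rw [← Units.val_pow_eq_pow_val, ← pow_mul, mul_comm s, hk, Units.val_neg, Units.val_one]

/-! ### The induced path in `PSU(3, q)` -/

theorem mainTheorem11 (p n : ℕ) [Fact p.Prime] (hn : 1 ≤ n) (hq : p ^ n ≠ 2) :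
    ¬ IsCograph (powerGraph (PSU 3 p n)) := by
  obtain ⟨l, i, hl, hl2, hl3, hi⟩ := GFSq.exists_norm_one_and_norm_neg_one p n hn hq
  have hpq : p ∣ p ^ n := dvd_pow_self p (by omega)
  have hp : p.Prime := Fact.out
  have hqpos : 0 < p ^ n := pow_pos hp.pos n
  -- A nonzero element of trace zero, as `l` is not fixed by the conjugation.
  let t : GFSq p n := l - star l
  have ht : star t = -t := by simp [t]
  have ht0 : t ≠ 0 := fun h => hl2 (by linear_combination l * h + hl)
  let A : SU 3 p n := ⟨transvectionMatrix t i 1, transvectionMatrix_mem ht hi (by simp)⟩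
  let A' : SU 3 p n := ⟨transvectionMatrix t i l, transvectionMatrix_mem ht hi hl⟩
  let C : SU 3 p n := ⟨planeScalarMatrix l, planeScalarMatrix_mem hl⟩
  let P : SU 3 p n := ⟨cyclicMatrix _, cyclicMatrix_mem⟩
  have hA : A ^ p = 1 := Subtype.ext (transvectionMatrix_pow_char p hi (by simp))
  have hA' : A' ^ p = 1 := Subtype.ext (transvectionMatrix_pow_char p hi hl)
  have hC : C ^ (p ^ n + 1) = 1 :=
    Subtype.ext (planeScalarMatrix_pow_eq_one (by rw [pow_succ', ← GFSq.star_eq, hl]))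
  have hAC : Commute A C := Subtype.ext (commute_transvectionMatrix_planeScalarMatrix t i 1 l).eq
  have hA'C : Commute A' C := Subtype.ext (commute_transvectionMatrix_planeScalarMatrix t i l l).eq
  have hAA' : ¬ Commute A A' := fun h =>
    not_commute_transvectionMatrix ht0 hi hl hl2 (congrArg Subtype.val h.eq)
  let π : SU 3 p n →* PSU 3 p n := QuotientGroup.mk' _
  have hπ (x y : SU 3 p n) (hx : π x = 1) : Commute x y :=
    ((Subgroup.mem_center_iff.mp ((QuotientGroup.eq_one_iff x).mp hx)) y).symm
  have hπAA' : ¬ Commute (π A) (π A') := by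
    intro h
    have h1 : π ((A * A')⁻¹ * (A' * A)) = 1 := by
      rw [map_mul, map_inv, map_mul, map_mul, h.eq, inv_mul_cancel]
    have h2 : A' * A = A * A' * ((A * A')⁻¹ * (A' * A)) := by rw [mul_inv_cancel_left]
    exact hAA' (Subtype.ext (commute_transvectionMatrix_of_eq_mul
      (congrArg Subtype.val (hπ _ P h1).eq) (congrArg Subtype.val h2)).eq)
  have hCq : C ^ (p ^ n) ^ 2 = C := by
    obtain ⟨r, hr⟩ : ∃ r, p ^ n = r + 1 := ⟨p ^ n - 1, by omega⟩
    rw [show (p ^ n) ^ 2 = (p ^ n + 1) * r + 1 by rw [hr]; ring, pow_succ, pow_mul, hC, one_pow,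
      one_mul]
  have hpow (x : SU 3 p n) (hx : x ^ p = 1) : x ^ p ^ n = 1 := by
    obtain ⟨s, hs⟩ := hpq
    rw [hs, pow_mul, hx, one_pow]
  have hxC (x : SU 3 p n) (hx : x ^ p = 1) (h : Commute x C) : (x * C) ^ (p ^ n) ^ 2 = C := by
    rw [h.mul_pow, hCq, sq, pow_mul, hpow x hx, one_pow, one_mul]
  have hba : (A * C) ^ (p ^ n + 1) = A := by
    rw [hAC.mul_pow, hC, pow_succ, hpow A hA, one_mul, mul_one]
  refine not_isCograph_powerGraph (a := π A) (b := π (A * C)) (c := π C) (d := π (A' * C))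
    (k := p ^ n + 1) (l := (p ^ n) ^ 2) (m := (p ^ n) ^ 2) (by positivity) (by positivity)
    (by positivity) (by rw [← map_pow, hba]) (by rw [← map_pow, hxC A hA hAC])
    (by rw [← map_pow, hxC A' hA' hA'C]) (fun h => hAA' (hπ A A' h)) ?_ ?_ ?_
  · exact fun h => not_commute_planeScalarMatrix_cyclicMatrix hl hl3
      (congrArg Subtype.val (hπ C P h).eq)
  · have h1 : orderOf (π A) ∣ p := orderOf_dvd_of_pow_eq_one (by rw [← map_pow, hA, map_one])
    have h2 : orderOf (π C) ∣ p ^ n + 1 :=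
      orderOf_dvd_of_pow_eq_one (by rw [← map_pow, hC, map_one])
    have h3 : p.Coprime (p ^ n + 1) :=
      Nat.Coprime.of_dvd_left hpq (by simp)
    exact (h3.of_dvd_left h1).of_dvd_right h2
  · intro h
    have hCinv : Commute (π A) (π C)⁻¹ := (hAC.map π).inv_right
    have h1 := h.mul_right hCinv
    rw [map_mul, mul_inv_cancel_right] at h1
    exact hπAA' h1
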